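/- Conventions. For a pseudo-functor $F\colon\mathcal B\to\mathcal C$ between bicategories write $F^2_{g,f}\colon Fg\circ Ff\simeq F(gf)$ for its functoriality constraint and $F^{-2}_{g,f}$ for the inverse. For $E\in\mathcal C$ let $\Delta E\colon\mathcal B\to\mathcal C$ be the constant pseudo-functor at $E$, and let $[\mathcal B,\mathcal C](F,\Delta E)$ be the category of pseudo-natural transformations $F\Rightarrow\Delta E$ (the pseudo-cocones on $F$ with apex $E$) and modifications. A non-empty bicategory $\mathcal B$ is \emph{pseudofiltered} if every pseudo-functor $\mathcal J\to\mathcal B$ has a pseudo-cocone whenever $\mathcal J$ is a finite bicategory (finitely many objects, arrows and 2-cells) that is connected (any two objects are linked by a finite zig-zag of arrows). A \emph{pseudo-colimit} of $F\colon\mathcal B\to\mathbf{Cat}$ is a category $L$ together with a pseudo-cocone $\theta\colon F\Rightarrow\Delta L$ such that, for every category $E$, composition with $\theta$ is an isomorphism of categories $\mathbf{Cat}(L,E)\cong[\mathcal B,\mathbf{Cat}](F,\Delta E)$. Here $\mathbf{Cat}$ is the 2-category of categories of a size large enough, relative to the objects and arrows of $\mathcal B$, to contain the category constructed below. \textbf{Proposition.}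 Let $\mathcal B$ be a pseudofiltered bicategory and $F\colon\mathcal B\to\mathbf{Cat}$ a pseudo-functor. The following data define a category $\operatorname{Colim}_{\mathcal B}F$, and it is a pseudo-colimit of $F$. \begin{itemize} \item \emph{Objects}: pairs $(A,x)$ with $A$ an object of $\mathcal B$ and $x$ an object of $FA$. \item \emph{Premorphisms} $(A,x)\to(B,y)$: quadruples $(C,u,v,\xi)$ with $C$ an object of $\mathcal B$, arrows $u\colon A\to C$ and $v\colon B\to C$, and an arrow $\xi\colon Fu(x)\to Fv(y)$ of $FC$. \item \emph{Homotopies} $(C_1,u_1,v_1,\xi_1)\equiv(C_2,u_2,v_2,\xi_2)$: quintuples $(C,w_1,w_2,\alpha,\beta)$ with $C$ an object of $\mathcal B$, arrows $w_1\colon C_1\to C$ and $w_2\colon C_2\to C$, and invertible 2-cells $\alpha\colon w_1u_1\simeq w_2u_2$ and $\beta\colon w_1v_1\simeq w_2v_2$ such that \[Fw_2(\xi_2)\circ(F^{-2}_{w_2,u_2})_x\circ(F\alpha)_x\circ(F^2_{w_1,u_1})_x=(F^{-2}_{w_2,v_2})_y\circ(F\beta)_y\circ(F^2_{w_1,v_1})_y\circ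 Fw_1(\xi_1).\] \item \emph{Arrows}: classes of premorphisms, two premorphisms being identified if there is a homotopy between them; this relation is an equivalence relation. \item \emph{Identities}: $1_{(A,x)}=[(A,1_A,1_A,1_{F1_A(x)})]$. \item \emph{Composition}: for premorphisms $(C_1,u_1,v_1,\xi_1)\colon(A,x)\to(B,y)$ and $(C_2,u_2,v_2,\xi_2)\colon(B,y)\to(C,z)$ there exist an object $D$, arrows $f\colon C_1\to D$ and $g\colon C_2\to D$, and an invertible 2-cell $\gamma\colon fv_1\simeq gu_2$; and for any such $D,f,g,\gamma$, \[[(C_2,u_2,v_2,\xi_2)]\circ[(C_1,u_1,v_1,\xi_1)]=[(D,fu_1,gv_2,\zeta)],\] \[\zeta=(F^{2}_{g,v_2})_z\circ Fg(\xi_2)\circ(F^{-2}_{g,u_2})_y\circ(F\gamma)_y\circ(F^{2}_{f,v_1})_y\circ Ff(\xi_1)\circ(F^{-2}_{f,u_1})_x,\] independently of the choice of representatives and of $D,f,g,\gamma$. \end{itemize} -/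

import Mathlib

universe w₁ w₂ v₁ v₂ u₁ u₂ v u

namespace PseudoColim

open CategoryTheory Bicategory
open scoped Pseudofunctor.StrongTrans

section Cocones

variable {B : Type u₁} [Bicategory.{w₁, v₁} B] {C : Type u₂} [Bicategory.{w₂, v₂} C]

variable (B)

/-- The constant pseudofunctor `Δ E`: every object goes to `E`, every arrow to `𝟙 E`, every
2-cell to an identity. -/
def const (E : C) : B ⥤ᵖ C where
  obj _ := E
  map _ := 𝟙 E
  map₂ _ := 𝟙 (𝟙 E)
  mapId _ := Iso.refl (𝟙 E)
  mapComp _ _ := (λ_ (𝟙 E)).symm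
  map₂_whisker_left := by intros; simp
  map₂_whisker_right := by intros; simp
  map₂_associator := by intros; simp
  map₂_left_unitor := by intros; simp
  map₂_right_unitor := by intros; simp [unitors_equal]

/-- The pseudonatural transformation `Δ G : Δ L ⟶ Δ E` with all components `G : L ⟶ E`. -/
def constMap {L E : C} (G : L ⟶ E) : const B L ⟶ const B E :=
  ({
    app := fun _ => G
    naturality := fun _ => λ_ G ≪≫ (ρ_ G).symm
    naturality_naturality := fun _ => by
      have h : 𝟙 (𝟙 L) ▷ G ≫ (λ_ G ≪≫ (ρ_ G).symm).hom =
          (λ_ G ≪≫ (ρ_ G).symm).hom ≫ G ◁ 𝟙 (𝟙 E) := by simp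
      exact h
    naturality_id := fun _ => by
      have h : (λ_ G ≪≫ (ρ_ G).symm).hom ≫ G ◁ 𝟙 (𝟙 E) =
          𝟙 (𝟙 L) ▷ G ≫ (λ_ G).hom ≫ (ρ_ G).inv := by simp
      exact h
    naturality_comp := fun _ _ => by
      have h : (λ_ G ≪≫ (ρ_ G).symm).hom ≫ G ◁ (λ_ (𝟙 E)).inv =
          (λ_ (𝟙 L)).inv ▷ G ≫ (α_ (𝟙 L) (𝟙 L) G).hom ≫ 𝟙 L ◁ (λ_ G ≪≫ (ρ_ G).symm).hom ≫
            (α_ (𝟙 L) G (𝟙 E)).inv ≫ (λ_ G ≪≫ (ρ_ G).symm).hom ▷ 𝟙 E ≫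
              (α_ G (𝟙 E) (𝟙 E)).hom := by
        simp [unitors_inv_equal]
      exact h } : Pseudofunctor.StrongTrans (const B L) (const B E))

/-- The modification `Δ σ : Δ G ⟶ Δ H` with all components `σ : G ⟶ H`. -/
def constMap₂ {L E : C} {G H : L ⟶ E} (σ : G ⟶ H) : constMap B G ⟶ constMap B H where
  as :=
    { app := fun _ => σ
      naturality := fun _ => by
        have h : 𝟙 L ◁ σ ≫ (λ_ H ≪≫ (ρ_ H).symm).hom =
            (λ_ G ≪≫ (ρ_ G).symm).hom ≫ σ ▷ 𝟙 E := by simp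
        exact h }

variable {B}

/-- A pseudo-cocone on `F` with apex `L`: a pseudonatural transformation `F ⟶ Δ L`. -/
abbrev PseudoCocone (F : B ⥤ᵖ C) (L : C) := F ⟶ const B L

/-- The functor `C(L, E) ⥤ [B, C](F, Δ E)`, `G ↦ Δ G ∘ θ`, `σ ↦ Δ σ ⋆ θ`, induced by a
pseudo-cocone `θ`. The category on the right is that of pseudonatural transformations
and modifications. -/
def inducedFunctor {F : B ⥤ᵖ C} {L : C} (θ : PseudoCocone F L) (E : C) :
    (L ⟶ E) ⥤ PseudoCocone F E where
  obj G := θ ≫ constMap B G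
  map σ := θ ◁ constMap₂ B σ
  map_id G := whiskerLeft_id θ (constMap B G)
  map_comp σ τ := whiskerLeft_comp θ (constMap₂ B σ) (constMap₂ B τ)

/-- `L` is a pseudo-colimit of `F`: it strictly represents `E ↦ [B, C](F, Δ E)`. That is, there is
a pseudo-cocone `θ` with apex `L` such that for every `E` the functor
`C(L, E) ⥤ [B, C](F, Δ E)` induced by `θ` is an isomorphism of categories
(bijective on objects and on hom-sets). -/
def IsPseudoColimit (F : B ⥤ᵖ C) (L : C) : Prop :=
  ∃ θ : PseudoCocone F L, ∀ E : C,
    Function.Bijective (inducedFunctor θ E).obj ∧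
      ∀ G H : L ⟶ E, Function.Bijective
        (fun σ : G ⟶ H => (inducedFunctor θ E).map σ)

/-- A bicategory with finitely many objects, arrows and 2-cells. -/
structure IsFiniteBicategory (C : Type u₂) [Bicategory.{w₂, v₂} C] : Prop where
  finite_obj : Finite C
  finite_hom : ∀ a b : C, Finite (a ⟶ b)
  finite_hom₂ : ∀ (a b : C) (f g : a ⟶ b), Finite (f ⟶ g)

/-- A bicategory is connected when any two objects are linked by a finite zig-zag of arrows. -/
def IsConnectedBicategory (C : Type u₂) [Bicategory.{w₂, v₂} C] : Prop :=
  ∀ a b : C, Relation.EqvGen (fun x y : C => Nonempty (x ⟶ y)) a b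

/-- A non-empty bicategory is pseudofiltered when every finite connected diagram in it has a
pseudo-cocone. -/
structure IsPseudofiltered (B : Type u₁) [Bicategory.{w₁, v₁} B] : Prop where
  nonempty : Nonempty B
  exists_cocone : ∀ (J : Type) [Bicategory.{0, 0} J],
    IsFiniteBicategory J → IsConnectedBicategory J →
      ∀ D : J ⥤ᵖ B, ∃ E : B, Nonempty (PseudoCocone D E)

end Cocones

section Colim

variable {B : Type u₁} [Bicategory.{w₁, v₁} B]

/-- Objects of `Colim F`: pairs `(A, x)` with `x` an object of `F A`. -/
structure Obj (F : B ⥤ᵖ Cat.{v, u}) where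
  base : B
  fiber : F.obj base

variable {F : B ⥤ᵖ Cat.{v, u}}

/-- Premorphisms `(C, u, v, ξ) : (A, x) → (B, y)`, where `u : A ⟶ C`, `v : B ⟶ C` and
`ξ : F u (x) ⟶ F v (y)`. -/
structure Premorphism (X Y : Obj F) where
  apex : B
  left : X.base ⟶ apex
  right : Y.base ⟶ apex
  hom : (F.map left).toFunctor.obj X.fiber ⟶ (F.map right).toFunctor.obj Y.fiber

/-- Homotopies `(C, w₁, w₂, α, β)` between premorphisms. -/
structure Homotopy {X Y : Obj F} (p q : Premorphism X Y) where
  apex : B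
  w₁ : p.apex ⟶ apex
  w₂ : q.apex ⟶ apex
  α : p.left ≫ w₁ ≅ q.left ≫ w₂
  β : p.right ≫ w₁ ≅ q.right ≫ w₂
  comm :
    (F.mapComp p.left w₁).inv.toNatTrans.app X.fiber ≫
        (F.map₂ α.hom).toNatTrans.app X.fiber ≫
          (F.mapComp q.left w₂).hom.toNatTrans.app X.fiber ≫
            (F.map w₂).toFunctor.map q.hom =
      (F.map w₁).toFunctor.map p.hom ≫
        (F.mapComp p.right w₁).inv.toNatTrans.app Y.fiber ≫
          (F.map₂ β.hom).toNatTrans.app Y.fiber ≫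
            (F.mapComp q.right w₂).hom.toNatTrans.app Y.fiber

/-- Two premorphisms are homotopic when there is a homotopy between them. -/
def Homotopic {X Y : Obj F} (p q : Premorphism X Y) : Prop := Nonempty (Homotopy p q)

/-- Arrows of `Colim F`: premorphisms modulo homotopy. -/
def Arrow (X Y : Obj F) := Quot (Homotopic (X := X) (Y := Y))

/-- The class of a premorphism. -/
def Premorphism.cls {X Y : Obj F} (p : Premorphism X Y) : Arrow X Y := Quot.mk _ p

/-- The premorphism `(A, 1_A, 1_A, 1_{F 1_A (x)})`. -/
def Premorphism.id (X : Obj F) : Premorphism X X where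
  apex := X.base
  left := 𝟙 X.base
  right := 𝟙 X.base
  hom := 𝟙 ((F.map (𝟙 X.base)).toFunctor.obj X.fiber)

/-- A square `(D, f, g, γ : f v₁ ≅ g u₂)` for two composable premorphisms. -/
structure OreSquare {X Y Z : Obj F} (p : Premorphism X Y) (q : Premorphism Y Z) where
  apex : B
  f : p.apex ⟶ apex
  g : q.apex ⟶ apex
  γ : p.right ≫ f ≅ q.left ≫ g

/-- The composite premorphism of `p` and `q` formed with the square `s`. -/
def Premorphism.compOver {X Y Z : Obj F} (p : Premorphism X Y) (q : Premorphism Y Z)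
    (s : OreSquare p q) : Premorphism X Z where
  apex := s.apex
  left := p.left ≫ s.f
  right := q.right ≫ s.g
  hom :=
    (F.mapComp p.left s.f).hom.toNatTrans.app X.fiber ≫
      (F.map s.f).toFunctor.map p.hom ≫
        (F.mapComp p.right s.f).inv.toNatTrans.app Y.fiber ≫
          (F.map₂ s.γ.hom).toNatTrans.app Y.fiber ≫
            (F.mapComp q.left s.g).hom.toNatTrans.app Y.fiber ≫
              (F.map s.g).toFunctor.map q.hom ≫
                (F.mapComp q.right s.g).inv.toNatTrans.app Z.fiber

/-- A category structure on the pairs `(A, x)` whose arrows are the homotopy classes of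
premorphisms, whose identities are the classes of `Premorphism.id`, and in which the composite of
two classes is computed by `Premorphism.compOver` from any representatives and any square. -/
structure ColimCategory (F : B ⥤ᵖ Cat.{v, u}) where
  comp : ∀ {X Y Z : Obj F}, Arrow X Y → Arrow Y Z → Arrow X Z
  comp_cls : ∀ {X Y Z : Obj F} (p : Premorphism X Y) (q : Premorphism Y Z) (s : OreSquare p q),
    comp p.cls q.cls = (p.compOver q s).cls
  id_comp : ∀ {X Y : Obj F} (a : Arrow X Y), comp (Premorphism.id X).cls a = a
  comp_id : ∀ {X Y : Obj F} (a : Arrow X Y), comp a (Premorphism.id Y).cls = a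
  assoc : ∀ {X Y Z W : Obj F} (a : Arrow X Y) (b : Arrow Y Z) (c : Arrow Z W),
    comp (comp a b) c = comp a (comp b c)

/-- The underlying category. -/
@[reducible] def ColimCategory.category {F : B ⥤ᵖ Cat.{v, u}} (S : ColimCategory F) :
    Category.{max u₁ v₁ v} (Obj F) where
  Hom X Y := Arrow X Y
  id X := (Premorphism.id X).cls
  comp a b := S.comp a b
  id_comp := S.id_comp
  comp_id := S.comp_id
  assoc := S.assoc

/-- The underlying category, as an object of `Cat`. -/
def ColimCategory.toCat {F : B ⥤ᵖ Cat.{v, u}} (S : ColimCategory F) :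
    Cat.{max u₁ v₁ v, max u₁ u} :=
  letI := S.category
  Cat.of (Obj F)

end Colim

end PseudoColim

/-!
The proof rests on two reductions.

*Transport calculus.* For `X = (A, x)` and `u : A ⟶ C` write `X.along u` for `F u (x)`. A 2-cell
`α : u ⟶ u'` acts by `cell X α`, and an arrow `w : C ⟶ D` acts on arrows of `F C` by `push w`, which
is `F w` conjugated by the functoriality constraints of `F`. The laws `push_comp`, `push_cell`,
`push_exchange`, `push_push` and `push_unit` absorb all coherence of `F`. Homotopies become squares
`Sq`, which are closed under pasting and whiskering, so that only 2-cells of the base bicategory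
remain to be compared.

*Common apexes.* In a pseudofiltered bicategory spans complete to squares, parallel arrows become
isomorphic, parallel 2-cells become equal and all 2-cells become invertible after composing with
some arrow; each of these is a cocone on a fan-shaped diagram (`exists_fan_cocone`). Transitivity of
homotopy needs only spans. Composable arrows have representatives `(E, u, v, ξ)`, `(E, v, w, η)` with
a common apex and a common middle leg, and their composite is `(E, u, w, η ∘ ξ)`. That this is well
defined in every respect at once is `Homotopic.hcomp`: homotopies of both factors are brought to a
common apex on which their middle 2-cells agree (`exists_compatible`). The category axioms are then
those of the categories `F E`.

For the universal property, every arrow `(C, u, v, ξ)` factors as the image of `ξ` under the inclusion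
of `F C`, between isomorphisms `(C, F u (x)) ≅ (A, x)` and `(C, F v (y)) ≅ (B, y)` (`arr_eq`). The
inclusions and these isomorphisms form the universal cocone, whose compatibility with
non-invertible 2-cells holds because these become invertible (`arr_comp_cell`). A modification between cocones extends
uniquely to a natural transformation because they generate the category (`naturality_of_incl`), and a
cocone `ψ` induces the functor sending `(C, u, v, ξ)` to the conjugate of `ψ C (ξ)` by the structure
isomorphisms of `ψ` (`desc`). Injectivity on objects follows from fullness: a lift of the identity
modification has identities as components.
-/

namespace PseudoColim

open CategoryTheory Bicategory
open scoped Pseudofunctor.StrongTrans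

/-! ### Transport along arrows and 2-cells -/

section Transport

variable {B : Type u₁} [Bicategory.{w₁, v₁} B] {F : B ⥤ᵖ Cat.{v, u}}

/-- The object `F u (x)` of `F C`, for `X = (A, x)` and `u : A ⟶ C`. -/
abbrev Obj.along (X : Obj F) {C : B} (u : X.base ⟶ C) : F.obj C :=
  (F.map u).toFunctor.obj X.fiber

/-- The arrow `(F α)_x : F u (x) ⟶ F u' (x)` of `F C`, for `X = (A, x)` and a 2-cell `α : u ⟶ u'`. -/
def cell (X : Obj F) {C : B} {u u' : X.base ⟶ C} (α : u ⟶ u') : X.along u ⟶ X.along u' :=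
  (F.map₂ α).toNatTrans.app X.fiber

/-- The image of `ξ : F u (x) ⟶ F v (y)` under `F w`, conjugated by the functoriality constraints
of `F` to an arrow `F (w u) (x) ⟶ F (w v) (y)`. -/
def push {X Y : Obj F} {C D : B} {u : X.base ⟶ C} {v : Y.base ⟶ C} (w : C ⟶ D)
    (ξ : X.along u ⟶ Y.along v) : X.along (u ≫ w) ⟶ Y.along (v ≫ w) :=
  (F.mapComp u w).hom.toNatTrans.app X.fiber ≫ (F.map w).toFunctor.map ξ ≫
    (F.mapComp v w).inv.toNatTrans.app Y.fiber

/-- The constraint `F 1_C (x) ≅ x`. -/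
def unitIso (C : B) (x : F.obj C) : (⟨C, x⟩ : Obj F).along (𝟙 C) ≅ x :=
  (Cat.Hom.toNatIso (F.mapId C)).app x

variable {X Y Z : Obj F} {C D E : B}

@[simp]
lemma cell_id (u : X.base ⟶ C) : cell X (𝟙 u) = 𝟙 (X.along u) := by
  simp [cell]

lemma cell_comp {u u' u'' : X.base ⟶ C} (α : u ⟶ u') (β : u' ⟶ u'') :
    cell X (α ≫ β) = cell X α ≫ cell X β := by
  simp [cell]

@[simp]
lemma cell_hom_inv {u u' : X.base ⟶ C} (α : u ≅ u') :
    cell X α.hom ≫ cell X α.inv = 𝟙 (X.along u) := by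
  rw [← cell_comp, Iso.hom_inv_id, cell_id]

@[simp]
lemma cell_inv_hom {u u' : X.base ⟶ C} (α : u ≅ u') :
    cell X α.inv ≫ cell X α.hom = 𝟙 (X.along u') := by
  rw [← cell_comp, Iso.inv_hom_id, cell_id]

@[simp]
lemma cell_hom_inv_assoc {u u' : X.base ⟶ C} (α : u ≅ u') {z : F.obj C} (h : X.along u ⟶ z) :
    cell X α.hom ≫ cell X α.inv ≫ h = h := by
  rw [← Category.assoc, cell_hom_inv, Category.id_comp]

@[simp]
lemma cell_inv_hom_assoc {u u' : X.base ⟶ C} (α : u ≅ u') {z : F.obj C} (h : X.along u' ⟶ z) :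
    cell X α.inv ≫ cell X α.hom ≫ h = h := by
  rw [← Category.assoc, cell_inv_hom, Category.id_comp]

instance {u u' : X.base ⟶ C} (α : u ⟶ u') [IsIso α] : IsIso (cell X α) :=
  ⟨cell X (inv α), by rw [← cell_comp, IsIso.hom_inv_id, cell_id],
    by rw [← cell_comp, IsIso.inv_hom_id, cell_id]⟩

lemma push_id (u : X.base ⟶ C) (w : C ⟶ D) : push w (𝟙 (X.along u)) = 𝟙 (X.along (u ≫ w)) := by
  simp [push]

lemma push_comp {u : X.base ⟶ C} {v : Y.base ⟶ C} {t : Z.base ⟶ C} (w : C ⟶ D)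
    (ξ : X.along u ⟶ Y.along v) (η : Y.along v ⟶ Z.along t) :
    push w (ξ ≫ η) = push w ξ ≫ push w η := by
  simp [push]

lemma push_cell {u u' : X.base ⟶ C} (α : u ⟶ u') (w : C ⟶ D) :
    push w (cell X α) = cell X (α ▷ w) := by
  simp [push, cell]

lemma push_exchange {u : X.base ⟶ C} {v : Y.base ⟶ C} {w w' : C ⟶ D} (σ : w ⟶ w')
    (ξ : X.along u ⟶ Y.along v) :
    cell X (u ◁ σ) ≫ push w' ξ = push w ξ ≫ cell Y (v ◁ σ) := by
  simp [push, cell]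

lemma push_push {u : X.base ⟶ C} {v : Y.base ⟶ C} (w : C ⟶ D) (w' : D ⟶ E)
    (ξ : X.along u ⟶ Y.along v) :
    push w' (push w ξ) ≫ cell Y (α_ v w w').hom =
      cell X (α_ u w w').hom ≫ push (w ≫ w') ξ := by
  have := NatIso.naturality_1 (Cat.Hom.toNatIso (F.mapComp w w')) ξ
  simp only [Cat.Hom.toNatIso_hom, Cat.Hom.toNatIso_inv, Cat.Hom.comp_map] at this
  simp [push, cell]
  rw [← Functor.map_comp_assoc _ ((F.mapComp v w).inv.toNatTrans.app Y.fiber),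
    Cat.Hom.inv_hom_id_toNatTrans_app, CategoryTheory.Functor.map_id, Category.id_comp, ← this]
  simp only [Category.assoc, Cat.Hom.hom_inv_id_toNatTrans_app_assoc]

lemma push_unit {u : X.base ⟶ C} {v : Y.base ⟶ C} (ξ : X.along u ⟶ Y.along v) :
    push (𝟙 C) ξ ≫ cell Y (ρ_ v).hom = cell X (ρ_ u).hom ≫ ξ := by
  simp [push, cell]

/-- A square from `p` to `q`: after pushing `p` along `w₁` and `q` along `w₂`, the
2-cells `α` and `β` between the legs intertwine the two arrows. Homotopies are the squares with
invertible `α` and `β`. -/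
def Sq {u₁ : X.base ⟶ C} {v₁ : Y.base ⟶ C} {u₂ : X.base ⟶ D} {v₂ : Y.base ⟶ D}
    (w₁ : C ⟶ E) (w₂ : D ⟶ E) (α : u₁ ≫ w₁ ⟶ u₂ ≫ w₂) (β : v₁ ≫ w₁ ⟶ v₂ ≫ w₂)
    (p : X.along u₁ ⟶ Y.along v₁) (q : X.along u₂ ⟶ Y.along v₂) : Prop :=
  cell X α ≫ push w₂ q = push w₁ p ≫ cell Y β

namespace Sq

variable {C' D' E' : B}
variable {u₁ : X.base ⟶ C} {v₁ : Y.base ⟶ C} {t₁ : Z.base ⟶ C}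
  {u₂ : X.base ⟶ D} {v₂ : Y.base ⟶ D} {t₂ : Z.base ⟶ D}
  {u₃ : X.base ⟶ C'} {v₃ : Y.base ⟶ C'}
  {p : X.along u₁ ⟶ Y.along v₁} {q : X.along u₂ ⟶ Y.along v₂} {r : X.along u₃ ⟶ Y.along v₃}
  {w₁ : C ⟶ E} {w₂ : D ⟶ E} {w₃ : C' ⟶ E}

/-- The square of a 2-cell between two arrows to push along. -/
lemma ofCell {w₁' : C ⟶ E} (σ : w₁ ⟶ w₁') (p : X.along u₁ ⟶ Y.along v₁) :
    Sq w₁ w₁' (u₁ ◁ σ) (v₁ ◁ σ) p p :=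
  push_exchange σ p

lemma trans {α : u₁ ≫ w₁ ⟶ u₂ ≫ w₂} {β : v₁ ≫ w₁ ⟶ v₂ ≫ w₂}
    {α' : u₂ ≫ w₂ ⟶ u₃ ≫ w₃} {β' : v₂ ≫ w₂ ⟶ v₃ ≫ w₃}
    (h : Sq w₁ w₂ α β p q) (h' : Sq w₂ w₃ α' β' q r) : Sq w₁ w₃ (α ≫ α') (β ≫ β') p r := by
  rw [Sq, cell_comp, cell_comp, Category.assoc, h', reassoc_of% h]

lemma symm {α : u₁ ≫ w₁ ≅ u₂ ≫ w₂} {β : v₁ ≫ w₁ ≅ v₂ ≫ w₂} (h : Sq w₁ w₂ α.hom β.hom p q) :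
    Sq w₂ w₁ α.inv β.inv q p := by
  have h' := cell X α.inv ≫= h =≫ cell Y β.inv
  simpa [Sq] using h'.symm

/-- Squares sharing the middle 2-cell compose horizontally. -/
lemma hcomp {α : u₁ ≫ w₁ ⟶ u₂ ≫ w₂} {β : v₁ ≫ w₁ ⟶ v₂ ≫ w₂} {δ : t₁ ≫ w₁ ⟶ t₂ ≫ w₂}
    {p' : Y.along v₁ ⟶ Z.along t₁} {q' : Y.along v₂ ⟶ Z.along t₂}
    (h : Sq w₁ w₂ α β p q) (h' : Sq w₁ w₂ β δ p' q') : Sq w₁ w₂ α δ (p ≫ p') (q ≫ q') := by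
  rw [Sq, push_comp, push_comp, reassoc_of% h, h', Category.assoc]

lemma whisker {α : u₁ ≫ w₁ ⟶ u₂ ≫ w₂} {β : v₁ ≫ w₁ ⟶ v₂ ≫ w₂} (h : Sq w₁ w₂ α β p q)
    (m : E ⟶ E') :
    Sq (w₁ ≫ m) (w₂ ≫ m) ((α_ _ _ _).inv ≫ α ▷ m ≫ (α_ _ _ _).hom)
      ((α_ _ _ _).inv ≫ β ▷ m ≫ (α_ _ _ _).hom) p q := by
  have h' := congrArg (push m) h
  rw [push_comp, push_comp, push_cell, push_cell] at h'
  rw [Sq, ← cancel_epi (cell X (α_ u₁ w₁ m).hom)]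
  simp only [cell_comp, Category.assoc, cell_hom_inv_assoc, ← push_push,
    reassoc_of% h', ← reassoc_of% (push_push w₁ m p)]

end Sq

end Transport

/-! ### Homotopies as squares -/

section Homotopy

variable {B : Type u₁} [Bicategory.{w₁, v₁} B] {F : B ⥤ᵖ Cat.{v, u}} {X Y Z : Obj F}

/-- Homotopies are the squares with invertible 2-cells. -/
lemma homotopic_iff {p q : Premorphism X Y} :
    Homotopic p q ↔ ∃ (E : B) (w₁ : p.apex ⟶ E) (w₂ : q.apex ⟶ E)
      (α : p.left ≫ w₁ ≅ q.left ≫ w₂) (β : p.right ≫ w₁ ≅ q.right ≫ w₂),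
      Sq w₁ w₂ α.hom β.hom p.hom q.hom := by
  -- Conjugating by the constraints at the two ends turns one equation into the other.
  have key : ∀ (E : B) (w₁ : p.apex ⟶ E) (w₂ : q.apex ⟶ E)
      (α : p.left ≫ w₁ ≅ q.left ≫ w₂) (β : p.right ≫ w₁ ≅ q.right ≫ w₂),
      Sq w₁ w₂ α.hom β.hom p.hom q.hom ↔
    (F.mapComp p.left w₁).inv.toNatTrans.app X.fiber ≫
        (F.map₂ α.hom).toNatTrans.app X.fiber ≫
          (F.mapComp q.left w₂).hom.toNatTrans.app X.fiber ≫
            (F.map w₂).toFunctor.map q.hom =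
      (F.map w₁).toFunctor.map p.hom ≫
        (F.mapComp p.right w₁).inv.toNatTrans.app Y.fiber ≫
          (F.map₂ β.hom).toNatTrans.app Y.fiber ≫
            (F.mapComp q.right w₂).hom.toNatTrans.app Y.fiber := by
    intro E w₁ w₂ α β
    rw [← cancel_epi ((F.mapComp p.left w₁).hom.toNatTrans.app X.fiber),
      ← cancel_mono ((F.mapComp q.right w₂).inv.toNatTrans.app Y.fiber)]
    simp [Sq, push, cell]
  constructor
  · rintro ⟨h⟩
    exact ⟨h.apex, h.w₁, h.w₂, h.α, h.β, (key _ _ _ _ _).2 h.comm⟩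
  · rintro ⟨E, w₁, w₂, α, β, h⟩
    exact ⟨⟨E, w₁, w₂, α, β, (key _ _ _ _ _).1 h⟩⟩

lemma Homotopic.refl (p : Premorphism X Y) : Homotopic p p :=
  homotopic_iff.2 ⟨p.apex, 𝟙 _, 𝟙 _, Iso.refl _, Iso.refl _, by simp [Sq]⟩

lemma Homotopic.symm {p q : Premorphism X Y} (h : Homotopic p q) : Homotopic q p := by
  obtain ⟨E, w₁, w₂, α, β, h⟩ := homotopic_iff.1 h
  exact homotopic_iff.2 ⟨E, w₂, w₁, α.symm, β.symm, h.symm⟩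

/-- A premorphism is homotopic to its push along `w : C ⟶ D`, with the legs replaced by
isomorphic ones. -/
lemma homotopic_push (p : Premorphism X Y) {D : B} (w : p.apex ⟶ D) {u' : X.base ⟶ D}
    {v' : Y.base ⟶ D} (α : p.left ≫ w ≅ u') (β : p.right ≫ w ≅ v') :
    Homotopic p ⟨D, u', v', cell X α.inv ≫ push w p.hom ≫ cell Y β.hom⟩ := by
  refine homotopic_iff.2 ⟨D, w, 𝟙 D, α ≪≫ (ρ_ u').symm, β ≪≫ (ρ_ v').symm, ?_⟩
  rw [Sq, ← cancel_mono (cell Y (ρ_ v').hom)]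
  simp [push_unit, cell_comp]

end Homotopy

/-! ### Fan-shaped bicategories -/

section Fan

variable {R : Type} {H : R → Type}

/-- The objects of the fan with hom-categories `H r`: a source `none` and, for each `r : R`, a
target `some r`. -/
def Fan (_ : R → Type) := Option R

namespace Fan

/-- The arrows of the fan: identities, and the objects of `H r` as arrows from the source to the
target `r`. There are no composites besides those with identities. -/
inductive Hom (H : R → Type) : Option R → Option R → Type
  | id (a : Option R) : Hom H a a
  | leg {r : R} (h : H r) : Hom H none (some r)

/-- Composition of arrows of the fan. -/
def Hom.comp : ∀ {a b c : Option R}, Hom H a b → Hom H b c → Hom H a c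
  | _, _, _, .id _, g => g
  | _, _, _, .leg h, .id _ => .leg h

lemma Hom.comp_assoc {a b c d : Option R} (f : Hom H a b) (g : Hom H b c) (h : Hom H c d) :
    (f.comp g).comp h = f.comp (g.comp h) := by
  cases f <;> cases g <;> cases h <;> rfl

lemma Hom.comp_id {a b : Option R} (f : Hom H a b) : f.comp (.id b) = f := by
  cases f <;> rfl

lemma Hom.id_comp {a b : Option R} (f : Hom H a b) : (Hom.id a).comp f = f := rfl

variable [∀ r, Category.{0} (H r)]

/-- The 2-cells of the fan: identities of identities, and the arrows of `H r`. -/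
inductive Hom₂ : ∀ {a b : Option R}, Hom H a b → Hom H a b → Type
  | id (a : Option R) : Hom₂ (.id a) (.id a)
  | leg {r : R} {h h' : H r} (φ : h ⟶ h') : Hom₂ (.leg h) (.leg h')

/-- The identity 2-cells of the fan. -/
def Hom₂.refl : ∀ {a b : Option R} (f : Hom H a b), Hom₂ f f
  | _, _, .id a => .id a
  | _, _, .leg h => .leg (𝟙 h)

/-- Vertical composition of 2-cells of the fan. -/
def Hom₂.vcomp : ∀ {a b : Option R} {f g h : Hom H a b}, Hom₂ f g → Hom₂ g h → Hom₂ f h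
  | _, _, _, _, _, .id a, .id _ => .id a
  | _, _, _, _, _, .leg φ, .leg ψ => .leg (φ ≫ ψ)

/-- The hom-categories of the fan. -/
instance Hom.category (a b : Option R) : Category.{0} (Hom H a b) where
  Hom f g := Hom₂ f g
  id f := Hom₂.refl f
  comp φ ψ := Hom₂.vcomp φ ψ
  id_comp := by rintro _ _ (_ | φ) <;> simp [Hom₂.refl, Hom₂.vcomp]
  comp_id := by rintro _ _ (_ | φ) <;> simp [Hom₂.refl, Hom₂.vcomp]
  assoc := by rintro _ _ _ _ (_ | φ) (_ | ψ) (_ | χ) <;> simp [Hom₂.vcomp]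

/-- Left whiskering in the fan. -/
def Hom₂.whiskerLeft : ∀ {a b c : Option R} (f : Hom H a b) {g h : Hom H b c}, Hom₂ g h →
    Hom₂ (f.comp g) (f.comp h)
  | _, _, _, .id _, _, _, η => η
  | _, _, _, .leg h, _, _, .id _ => .leg (𝟙 h)

/-- Right whiskering in the fan. -/
def Hom₂.whiskerRight : ∀ {a b c : Option R} {f g : Hom H a b}, Hom₂ f g → ∀ (h : Hom H b c),
    Hom₂ (f.comp h) (g.comp h)
  | _, _, _, _, _, .id _, h => .refl h
  | _, _, _, _, _, .leg φ, .id _ => .leg φ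

lemma Hom₂.leg_congr {r : R} {h h' : H r} {φ ψ : h ⟶ h'} (e : φ = ψ) :
    Hom₂.leg φ = Hom₂.leg ψ := congrArg _ e

/-- The bicategory structure of the fan. Composition is strictly associative and unital, so the
associators and unitors come from equalities; all laws hold after inspecting the cells involved. -/
instance : Bicategory.{0, 0} (Fan H) where
  Hom a b := Hom H a b
  id a := .id a
  comp f g := Hom.comp f g
  homCategory a b := Hom.category a b
  whiskerLeft f _ _ η := Hom₂.whiskerLeft f η
  whiskerRight η h := Hom₂.whiskerRight η h
  associator f g h := eqToIso (C := Hom H _ _) (Hom.comp_assoc f g h)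
  leftUnitor f := eqToIso (C := Hom H _ _) (Hom.id_comp f)
  rightUnitor f := eqToIso (C := Hom H _ _) (Hom.comp_id f)
  whiskerLeft_id := by
    rintro _ _ _ (_ | f) (_ | g) <;> rfl
  whiskerLeft_comp := by
    rintro _ _ _ (_ | f) _ _ _ (_ | φ) (_ | ψ) <;>
      first | rfl | exact Hom₂.leg_congr (by simp)
  id_whiskerLeft := by
    rintro _ _ _ _ (_ | φ) <;> first | rfl | exact Hom₂.leg_congr (by simp)
  comp_whiskerLeft := by
    rintro _ _ _ _ (_ | f) (_ | g) _ _ (_ | φ) <;>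
      first | rfl | exact Hom₂.leg_congr (by simp)
  id_whiskerRight := by
    rintro _ _ _ (_ | f) (_ | g) <;> rfl
  comp_whiskerRight := by
    rintro _ _ _ _ _ _ (_ | φ) (_ | ψ) (_ | h) <;>
      first | rfl | exact Hom₂.leg_congr (by simp)
  whiskerRight_id := by
    rintro _ _ _ _ (_ | φ) <;> first | rfl | exact Hom₂.leg_congr (by simp)
  whiskerRight_comp := by
    rintro _ _ _ _ _ _ (_ | φ) (_ | g) (_ | h) <;>
      first | rfl | exact Hom₂.leg_congr (by simp)
  whisker_assoc := by
    rintro _ _ _ _ (_ | f) _ _ (_ | φ) (_ | h) <;>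
      first | rfl | exact Hom₂.leg_congr (by simp)
  whisker_exchange := by
    rintro _ _ _ _ _ _ _ (_ | φ) (_ | ψ) <;>
      first | rfl | exact Hom₂.leg_congr (by simp)
  pentagon := by
    rintro _ _ _ _ _ (_ | f) (_ | g) (_ | h) (_ | k) <;>
      first | rfl | exact Hom₂.leg_congr (by simp)
  triangle := by
    rintro _ _ _ (_ | f) (_ | g) <;> first | rfl | exact Hom₂.leg_congr (by simp)

section ToBicategory

variable {B : Type u₁} [Bicategory.{w₁, v₁} B] {b₀ : B} {b : R → B} (G : ∀ r, H r ⥤ (b₀ ⟶ b r))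

/-- The objects of the diagram given by `G`. -/
def diagramObj (b₀ : B) (b : R → B) : Option R → B
  | none => b₀
  | some r => b r

/-- The arrows of the diagram given by `G`. -/
def diagramMap : ∀ {x y : Option R}, Hom H x y → (diagramObj b₀ b x ⟶ diagramObj b₀ b y)
  | _, _, .id _ => 𝟙 _
  | _, _, .leg h => (G _).obj h

/-- The 2-cells of the diagram given by `G`. -/
def diagramMap₂ : ∀ {x y : Option R} {f g : Hom H x y}, Hom₂ f g →
    (diagramMap G f ⟶ diagramMap G g)
  | _, _, _, _, .id _ => 𝟙 _
  | _, _, _, _, .leg φ => (G _).map φ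

/-- The functoriality constraints of the diagram given by `G`. -/
def diagramMapComp : ∀ {x y z : Option R} (f : Hom H x y) (g : Hom H y z),
    diagramMap G (f.comp g) ≅ diagramMap G f ≫ diagramMap G g
  | _, _, _, .id _, g => (λ_ (diagramMap G g)).symm
  | _, _, _, .leg h, .id _ => (ρ_ (diagramMap G (.leg h))).symm

/-- Functors `G r : H r ⥤ (b₀ ⟶ b r)` define a pseudofunctor from the fan. -/
def diagram : Fan H ⥤ᵖ B where
  obj := diagramObj b₀ b
  map f := diagramMap G f
  map₂ η := diagramMap₂ G η
  map₂_id := by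
    rintro _ _ (_ | f)
    · rfl
    · exact (G _).map_id f
  map₂_comp := by
    rintro _ _ _ _ _ (_ | φ) (_ | ψ)
    · exact (Category.comp_id _).symm
    · exact (G _).map_comp φ ψ
  mapId _ := Iso.refl _
  mapComp f g := diagramMapComp G f g
  map₂_whisker_left := by
    rintro _ _ _ (_ | f) _ _ (_ | φ)
    · have h (a : B) : 𝟙 (𝟙 a) =
          (λ_ _).inv ≫ 𝟙 _ ◁ 𝟙 (𝟙 a) ≫ (λ_ _).hom := by simp
      exact h _
    · have h : (G _).map φ = (λ_ _).inv ≫ 𝟙 _ ◁ (G _).map φ ≫ (λ_ _).hom := by simp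
      exact h
    · have h : (G _).map (𝟙 f) =
          (ρ_ _).inv ≫ (G _).obj f ◁ 𝟙 (𝟙 _) ≫ (ρ_ _).hom := by simp
      exact h
  map₂_whisker_right := by
    rintro _ _ _ _ _ (_ | φ) (_ | f)
    · have h (a : B) : 𝟙 (𝟙 a) =
          (λ_ _).inv ≫ 𝟙 (𝟙 a) ▷ 𝟙 _ ≫ (λ_ _).hom := by simp
      exact h _
    · have h : (G _).map (𝟙 f) = (λ_ _).inv ≫ 𝟙 (𝟙 _) ▷ (G _).obj f ≫ (λ_ _).hom := by simp
      exact h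
    · have h : (G _).map φ = (ρ_ _).inv ≫ (G _).map φ ▷ 𝟙 _ ≫ (ρ_ _).hom := by simp
      exact h
  map₂_associator := by
    rintro _ _ _ _ (_ | f) (_ | g) (_ | k)
    · have h (a : B) : 𝟙 (𝟙 a) = (λ_ _).inv ≫ (λ_ _).inv ▷ _ ≫ (α_ _ _ _).hom ≫
          _ ◁ (λ_ _).hom ≫ (λ_ _).hom := by simp
      exact h _
    · have h : (G _).map (𝟙 k) = (λ_ _).inv ≫ (λ_ _).inv ▷ _ ≫ (α_ _ _ _).hom ≫
          _ ◁ (λ_ _).hom ≫ (λ_ _).hom := by simp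
      exact h
    · have h : (G _).map (𝟙 g) = (ρ_ _).inv ≫ (λ_ _).inv ▷ _ ≫ (α_ _ _ _).hom ≫
          _ ◁ (ρ_ _).hom ≫ (λ_ _).hom := by simp
      exact h
    · have h : (G _).map (𝟙 f) = (ρ_ _).inv ≫ (ρ_ _).inv ▷ _ ≫ (α_ _ _ _).hom ≫
          _ ◁ (λ_ _).hom ≫ (ρ_ _).hom := by simp
      exact h
  map₂_left_unitor := by
    rintro _ _ (_ | f)
    · have h (a : B) : 𝟙 (𝟙 a) =
          (λ_ _).inv ≫ 𝟙 (𝟙 _) ▷ 𝟙 _ ≫ (λ_ _).hom := by simp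
      exact h _
    · have h : (G _).map (𝟙 f) = (λ_ _).inv ≫ 𝟙 (𝟙 _) ▷ (G _).obj f ≫ (λ_ _).hom := by simp
      exact h
  map₂_right_unitor := by
    rintro _ _ (_ | f)
    · have h (a : B) : 𝟙 (𝟙 a) =
          (λ_ _).inv ≫ 𝟙 _ ◁ 𝟙 (𝟙 _) ≫ (ρ_ _).hom := by simp
      exact h _
    · have h : (G _).map (𝟙 f) = (ρ_ _).inv ≫ (G _).obj f ◁ 𝟙 (𝟙 _) ≫ (ρ_ _).hom := by simp
      exact h

end ToBicategory

lemma isConnectedBicategory [∀ r, Nonempty (H r)] : IsConnectedBicategory (Fan H) := by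
  have key : ∀ x : Fan H,
      Relation.EqvGen (fun x y : Fan H => Nonempty (x ⟶ y)) (none : Option R) x := by
    rintro (_ | r)
    · exact .refl _
    · exact .rel _ _ ⟨Hom.leg (Classical.arbitrary (H r))⟩
  exact fun x y => .trans _ _ _ (.symm _ _ (key x)) (key y)

variable [Finite R] [∀ r, Finite (H r)] [∀ r (h h' : H r), Finite (h ⟶ h')]

instance : Finite (Fan H) := inferInstanceAs (Finite (Option R))

instance Hom.finite (x y : Option R) : Finite (Hom H x y) := by
  rcases x with _ | r <;> rcases y with _ | s
  · exact @Finite.of_subsingleton _ ⟨by rintro ⟨⟩ ⟨⟩; rfl⟩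
  · exact Finite.of_surjective (fun h : H s => Hom.leg h) (by rintro (_ | h); exact ⟨h, rfl⟩)
  · exact @Finite.of_subsingleton _ ⟨by rintro ⟨⟩⟩
  · exact @Finite.of_subsingleton _ ⟨by rintro ⟨⟩ ⟨⟩; rfl⟩

lemma isFiniteBicategory : IsFiniteBicategory (Fan H) where
  finite_obj := inferInstance
  finite_hom x y := Hom.finite x y
  finite_hom₂ := by
    rintro _ _ (_ | h) (_ | h')
    · exact @Finite.of_subsingleton _ ⟨by rintro ⟨⟩ ⟨⟩; rfl⟩
    · exact Finite.of_surjective (fun φ : h ⟶ h' => Hom₂.leg φ) (by rintro (_ | φ); exact ⟨φ, rfl⟩)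

end Fan
end Fan

/-! ### Elementary consequences of pseudofilteredness -/

section Filtered

variable {B : Type u₁} [Bicategory.{w₁, v₁} B]

/-- A cocone on a fan-shaped diagram, with the component at the source read as the common
value of the composites of the legs. -/
lemma IsPseudofiltered.exists_fan_cocone (hB : IsPseudofiltered B) {R : Type} {H : R → Type}
    [∀ r, Category.{0} (H r)] [Finite R] [∀ r, Finite (H r)] [∀ r (h h' : H r), Finite (h ⟶ h')]
    [∀ r, Nonempty (H r)] {b₀ : B} {b : R → B} (G : ∀ r, H r ⥤ (b₀ ⟶ b r)) :
    ∃ (E : B) (s : b₀ ⟶ E) (t : ∀ r, b r ⟶ E) (e : ∀ r (h : H r), (G r).obj h ≫ t r ≅ s),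
      ∀ r (h h' : H r) (φ : h ⟶ h'), (G r).map φ ▷ t r ≫ (e r h').hom = (e r h).hom := by
  obtain ⟨E, ⟨θ⟩⟩ := hB.exists_cocone (Fan H) Fan.isFiniteBicategory Fan.isConnectedBicategory
    (Fan.diagram G)
  let nat (r : R) (h : H r) : (G r).obj h ≫ θ.app (some r : Option R) ≅
      θ.app (none : Option R) ≫ 𝟙 E :=
    θ.naturality (a := (none : Option R)) (b := (some r : Option R)) (Fan.Hom.leg h)
  refine ⟨E, θ.app (none : Option R), fun r => θ.app (some r : Option R),
    fun r h => nat r h ≪≫ ρ_ _, fun r h h' φ => ?_⟩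
  -- The constant cocone has structure arrow `𝟙 E`; it is removed by a unitor.
  have strip {X Y : B} {f f' : X ⟶ Y} (m : f ⟶ f') (t : Y ⟶ E) (s : X ⟶ E) (n : f ≫ t ≅ s ≫ 𝟙 E)
      (n' : f' ≫ t ≅ s ≫ 𝟙 E) (e : m ▷ t ≫ n'.hom = n.hom ≫ s ◁ 𝟙 (𝟙 E)) :
      m ▷ t ≫ (n' ≪≫ ρ_ s).hom = (n ≪≫ ρ_ s).hom := by
    rw [Iso.trans_hom, reassoc_of% e]
    simp
  exact strip _ _ _ _ _ (θ.naturality_naturality (a := (none : Option R)) (b := (some r : Option R))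
    (f := Fan.Hom.leg h) (g := Fan.Hom.leg h') (Fan.Hom₂.leg φ))

/-- Spans in a pseudofiltered bicategory can be completed to squares. -/
lemma IsPseudofiltered.exists_span (hB : IsPseudofiltered B) {A C D : B} (f : A ⟶ C) (g : A ⟶ D) :
    ∃ (E : B) (s : C ⟶ E) (t : D ⟶ E), Nonempty (f ≫ s ≅ g ≫ t) := by
  obtain ⟨E, s, t, e, -⟩ := hB.exists_fan_cocone (R := Bool) (H := fun _ => Discrete PUnit)
    (b := fun r => bif r then C else D)
    (fun r => (Functor.const _).obj (match r with | true => f | false => g))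
  exact ⟨E, t true, t false, ⟨e true ⟨⟨⟩⟩ ≪≫ (e false ⟨⟨⟩⟩).symm⟩⟩

/-- Parallel arrows in a pseudofiltered bicategory become isomorphic after some composition. -/
lemma IsPseudofiltered.exists_iso (hB : IsPseudofiltered B) {A C : B} (f g : A ⟶ C) :
    ∃ (E : B) (s : C ⟶ E), Nonempty (f ≫ s ≅ g ≫ s) := by
  obtain ⟨E, s, t, e, -⟩ := hB.exists_fan_cocone (R := Unit) (H := fun _ => Discrete Bool)
    (fun _ => Discrete.functor fun r => bif r then f else g)
  exact ⟨E, t (), ⟨e () ⟨true⟩ ≪≫ (e () ⟨false⟩).symm⟩⟩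

/-- Parallel 2-cells in a pseudofiltered bicategory become equal after some whiskering. -/
lemma IsPseudofiltered.exists_eq (hB : IsPseudofiltered B) {A C : B} {f g : A ⟶ C} (α β : f ⟶ g) :
    ∃ (E : B) (s : C ⟶ E), α ▷ s = β ▷ s := by
  obtain ⟨E, s, t, e, h⟩ := hB.exists_fan_cocone (R := Unit)
    (H := fun _ => Limits.WalkingParallelPair) (fun _ => Limits.parallelPair α β)
  refine ⟨E, t (), ?_⟩
  rw [← cancel_mono (e () .one).hom]
  exact (h () _ _ .left).trans (h () _ _ .right).symm

/-- Every 2-cell of a pseudofiltered bicategory becomes invertible after some whiskering. -/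
lemma IsPseudofiltered.exists_isIso (hB : IsPseudofiltered B) {A C : B} {f g : A ⟶ C} (α : f ⟶ g) :
    ∃ (E : B) (s : C ⟶ E), IsIso (α ▷ s) := by
  obtain ⟨E, s, t, e, h⟩ := hB.exists_fan_cocone (R := Unit)
    (H := fun _ => Limits.WalkingParallelPair) (fun _ => Limits.parallelPair α α)
  have h' : α ▷ t () ≫ (e () .one).hom = (e () .zero).hom := h () _ _ .left
  refine ⟨E, t (), ?_⟩
  rw [← Iso.eq_comp_inv] at h'
  rw [h']
  infer_instance

end Filtered

/-! ### Homotopy classes and their composition -/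

section Composition

variable {B : Type u₁} [Bicategory.{w₁, v₁} B]

/-- The invertible 2-cell `f (s m) ≅ g (t m)` obtained from `e : f s ≅ g t` by whiskering. -/
abbrev whiskerAssoc {A C D E E' : B} {f : A ⟶ C} {g : A ⟶ D} {s : C ⟶ E} {t : D ⟶ E}
    (e : f ≫ s ≅ g ≫ t) (m : E ⟶ E') : f ≫ s ≫ m ≅ g ≫ t ≫ m :=
  (α_ f s m).symm ≪≫ whiskerRightIso e m ≪≫ α_ g t m

/-- Two invertible 2-cells comparing the same pair `v`, `v'` after different compositions agree
after further composition. -/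
lemma IsPseudofiltered.exists_compatible (hB : IsPseudofiltered B) {V E E' K L : B}
    {v : V ⟶ E} {v' : V ⟶ E'} {s : E ⟶ K} {s' : E' ⟶ K} {t : E ⟶ L} {t' : E' ⟶ L}
    (β : v ≫ s ≅ v' ≫ s') (β' : v ≫ t ≅ v' ≫ t') :
    ∃ (M : B) (m : K ⟶ M) (n : L ⟶ M) (σ : s ≫ m ≅ t ≫ n) (σ' : s' ≫ m ≅ t' ≫ n),
      v ◁ σ.hom ≫ (whiskerAssoc β' n).hom = (whiskerAssoc β m).hom ≫ v' ◁ σ'.hom := by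
  -- First the two `σ`s are found separately; composing further with `k` makes them compatible.
  obtain ⟨M₁, m, n, ⟨σ⟩⟩ := hB.exists_span s t
  obtain ⟨M₂, r, ⟨ρ⟩⟩ := hB.exists_iso (s' ≫ m) (t' ≫ n)
  let σ₂ : s ≫ m ≫ r ≅ t ≫ n ≫ r := whiskerAssoc σ r
  let σ₂' : s' ≫ m ≫ r ≅ t' ≫ n ≫ r := (α_ _ _ _).symm ≪≫ ρ ≪≫ α_ _ _ _
  obtain ⟨M, k, hk⟩ := hB.exists_eq (v ◁ σ₂.hom ≫ (whiskerAssoc β' (n ≫ r)).hom)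
    ((whiskerAssoc β (m ≫ r)).hom ≫ v' ◁ σ₂'.hom)
  refine ⟨M, (m ≫ r) ≫ k, (n ≫ r) ≫ k, whiskerAssoc σ₂ k, whiskerAssoc σ₂' k, ?_⟩
  have h := (α_ v (s ≫ m ≫ r) k ≪≫ whiskerLeftIso v (α_ s (m ≫ r) k)).inv ≫= hk =≫
    (α_ v' (t' ≫ n ≫ r) k ≪≫ whiskerLeftIso v' (α_ t' (n ≫ r) k)).hom
  clear_value σ₂ σ₂'
  calc _ = _ := ?_
    _ = _ := h
    _ = _ := ?_
  · simp
  · simp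

variable {F : B ⥤ᵖ Cat.{v, u}} {X Y Z W : Obj F}

lemma Homotopic.trans (hB : IsPseudofiltered B) {p q r : Premorphism X Y} (h : Homotopic p q)
    (h' : Homotopic q r) : Homotopic p r := by
  obtain ⟨E, w₁, w₂, α, β, h⟩ := homotopic_iff.1 h
  obtain ⟨E', w₁', w₂', α', β', h'⟩ := homotopic_iff.1 h'
  obtain ⟨M, s, t, ⟨e⟩⟩ := hB.exists_span w₂ w₁'
  exact homotopic_iff.2 ⟨M, w₁ ≫ s, w₂' ≫ t,
    whiskerAssoc α s ≪≫ whiskerLeftIso q.left e ≪≫ whiskerAssoc α' t,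
    whiskerAssoc β s ≪≫ whiskerLeftIso q.right e ≪≫ whiskerAssoc β' t,
    (h.whisker s).trans ((Sq.ofCell e.hom q.hom).trans (h'.whisker t))⟩

lemma homotopic_equivalence (hB : IsPseudofiltered B) (X Y : Obj F) :
    Equivalence (Homotopic (X := X) (Y := Y)) :=
  ⟨Homotopic.refl, Homotopic.symm, Homotopic.trans hB⟩

lemma cls_eq_iff (hB : IsPseudofiltered B) {p q : Premorphism X Y} :
    p.cls = q.cls ↔ Homotopic p q :=
  Quot.eq.trans (homotopic_equivalence hB X Y).eqvGen_iff

/-- Pushing a premorphism and replacing its legs by isomorphic ones does not change its class. -/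
lemma cls_push (p : Premorphism X Y) {D : B} (w : p.apex ⟶ D) {u' : X.base ⟶ D}
    {v' : Y.base ⟶ D} (α : p.left ≫ w ≅ u') (β : p.right ≫ w ≅ v') :
    (⟨D, u', v', cell X α.inv ≫ push w p.hom ≫ cell Y β.hom⟩ : Premorphism X Y).cls = p.cls :=
  (Quot.sound (homotopic_push p w α β)).symm

lemma nonempty_oreSquare (hB : IsPseudofiltered B) (p : Premorphism X Y) (q : Premorphism Y Z) :
    Nonempty (OreSquare p q) := by
  obtain ⟨E, s, t, ⟨e⟩⟩ := hB.exists_span p.right q.left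
  exact ⟨⟨E, s, t, e⟩⟩

/-- Homotopies between composable premorphisms with a common apex can be composed, after making
their middle 2-cells agree. -/
lemma Homotopic.hcomp (hB : IsPseudofiltered B) {E E' : B} {u : X.base ⟶ E} {v : Y.base ⟶ E}
    {w : Z.base ⟶ E} {u' : X.base ⟶ E'} {v' : Y.base ⟶ E'} {w' : Z.base ⟶ E'}
    {ξ : X.along u ⟶ Y.along v} {η : Y.along v ⟶ Z.along w}
    {ξ' : X.along u' ⟶ Y.along v'} {η' : Y.along v' ⟶ Z.along w'}
    (h : Homotopic ⟨E, u, v, ξ⟩ ⟨E', u', v', ξ'⟩) (h' : Homotopic ⟨E, v, w, η⟩ ⟨E', v', w', η'⟩) :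
    Homotopic ⟨E, u, w, ξ ≫ η⟩ ⟨E', u', w', ξ' ≫ η'⟩ := by
  obtain ⟨K, s, s', α, β, h⟩ := homotopic_iff.1 h
  obtain ⟨L, t, t', β', δ, h'⟩ := homotopic_iff.1 h'
  obtain ⟨M, m, n, σ, σ', e⟩ := hB.exists_compatible β β'
  have h₁ := h.whisker m
  -- The middle 2-cells of the two squares agree by compatibility.
  have e' : v ◁ σ.hom ≫ (whiskerAssoc β' n).hom ≫ v' ◁ σ'.inv = (whiskerAssoc β m).hom := by
    rw [reassoc_of% e, ← whiskerLeft_comp, Iso.hom_inv_id, whiskerLeft_id, Category.comp_id]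
  have h₂ : Sq (s ≫ m) (s' ≫ m) (whiskerAssoc β m).hom
      (whiskerLeftIso w σ ≪≫ whiskerAssoc δ n ≪≫ (whiskerLeftIso w' σ').symm).hom η η' := by
    rw [← e']
    exact (Sq.ofCell σ.hom η).trans ((h'.whisker n).trans (Sq.ofCell σ'.inv η'))
  exact homotopic_iff.2 ⟨M, s ≫ m, s' ≫ m, whiskerAssoc α m, _, h₁.hcomp h₂⟩

/-- `c` is a composite of `a` and `b`: there are representatives of `a` and `b` with a common apex
and a common leg at the middle object, and `c` is represented by the composite of their arrows in
the fiber over the apex. -/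
def IsComp (a : Arrow X Y) (b : Arrow Y Z) (c : Arrow X Z) : Prop :=
  ∃ (E : B) (u : X.base ⟶ E) (v : Y.base ⟶ E) (w : Z.base ⟶ E)
    (ξ : X.along u ⟶ Y.along v) (η : Y.along v ⟶ Z.along w),
    Premorphism.cls ⟨E, u, v, ξ⟩ = a ∧ Premorphism.cls ⟨E, v, w, η⟩ = b ∧
      Premorphism.cls ⟨E, u, w, ξ ≫ η⟩ = c

/-- Composites are independent of representatives, apexes and legs. -/
lemma IsComp.unique (hB : IsPseudofiltered B) {a : Arrow X Y} {b : Arrow Y Z} {c c' : Arrow X Z}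
    (h : IsComp a b c) (h' : IsComp a b c') : c = c' := by
  obtain ⟨E, u, v, w, ξ, η, ha, hb, rfl⟩ := h
  obtain ⟨E', u', v', w', ξ', η', ha', hb', rfl⟩ := h'
  exact Quot.sound (Homotopic.hcomp hB ((cls_eq_iff hB).1 (ha.trans ha'.symm))
    ((cls_eq_iff hB).1 (hb.trans hb'.symm)))

/-- The composite over a square is a composite in the sense of `IsComp`: push both premorphisms to
the apex of the square. -/
lemma isComp_compOver (p : Premorphism X Y) (q : Premorphism Y Z) (s : OreSquare p q) :
    IsComp p.cls q.cls (p.compOver q s).cls := by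
  refine ⟨s.apex, p.left ≫ s.f, q.left ≫ s.g, q.right ≫ s.g, _, _,
    cls_push p s.f (Iso.refl _) s.γ, cls_push q s.g (Iso.refl _) (Iso.refl _), ?_⟩
  simp [Premorphism.compOver, push, cell]

lemma exists_isComp (hB : IsPseudofiltered B) (a : Arrow X Y) (b : Arrow Y Z) :
    ∃ c, IsComp a b c := by
  obtain ⟨p, rfl⟩ := Quot.exists_rep a
  obtain ⟨q, rfl⟩ := Quot.exists_rep b
  exact (nonempty_oreSquare hB p q).elim fun s => ⟨_, isComp_compOver p q s⟩

/-- The class of an identity is represented by identities over all apexes. -/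
lemma cls_id (X : Obj F) {E : B} (u : X.base ⟶ E) :
    Premorphism.cls ⟨E, u, u, 𝟙 (X.along u)⟩ = (Premorphism.id X).cls := by
  rw [← cls_push (Premorphism.id X) u (λ_ u) (λ_ u)]
  simp [Premorphism.id, push_id]

/-- Three composable arrows have representatives with a common apex. -/
lemma exists_rep₃ (hB : IsPseudofiltered B) (a : Arrow X Y) (b : Arrow Y Z) (c : Arrow Z W) :
    ∃ (E : B) (u : X.base ⟶ E) (v : Y.base ⟶ E) (w : Z.base ⟶ E) (t : W.base ⟶ E)
      (ξ : X.along u ⟶ Y.along v) (η : Y.along v ⟶ Z.along w) (ζ : Z.along w ⟶ W.along t),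
      Premorphism.cls ⟨E, u, v, ξ⟩ = a ∧ Premorphism.cls ⟨E, v, w, η⟩ = b ∧
        Premorphism.cls ⟨E, w, t, ζ⟩ = c := by
  obtain ⟨_, D, u, v, w, ξ, η, rfl, rfl, -⟩ := exists_isComp hB a b
  obtain ⟨r, rfl⟩ := Quot.exists_rep c
  -- A common apex for the first two is completed with `r` to a square under the leg at `Z`.
  obtain ⟨E, f, g, ⟨γ⟩⟩ := hB.exists_span w r.left
  exact ⟨E, u ≫ f, v ≫ f, r.left ≫ g, r.right ≫ g, _, _, _,
    cls_push ⟨D, u, v, ξ⟩ f (Iso.refl _) (Iso.refl _),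
    cls_push ⟨D, v, w, η⟩ f (Iso.refl _) γ, cls_push r g (Iso.refl _) (Iso.refl _)⟩

/-- The category of pairs `(A, x)` and homotopy classes of premorphisms. -/
noncomputable def colimCategory (hB : IsPseudofiltered B) (F : B ⥤ᵖ Cat.{v, u}) : ColimCategory F :=
  have spec {X Y Z : Obj F} (a : Arrow X Y) (b : Arrow Y Z) :=
    Classical.choose_spec (exists_isComp hB a b)
  { comp := fun a b => Classical.choose (exists_isComp hB a b)
    comp_cls := fun p q s => IsComp.unique hB (spec _ _) (isComp_compOver p q s)
    id_comp := fun {X Y} a => by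
      obtain ⟨p, rfl⟩ := Quot.exists_rep a
      exact IsComp.unique hB (spec _ _) ⟨p.apex, p.left, p.left, p.right, 𝟙 _, p.hom, cls_id X _,
        rfl, by rw [Category.id_comp]; rfl⟩
    comp_id := fun {X Y} a => by
      obtain ⟨p, rfl⟩ := Quot.exists_rep a
      exact IsComp.unique hB (spec _ _) ⟨p.apex, p.left, p.right, p.right, p.hom, 𝟙 _, rfl,
        cls_id Y _, by rw [Category.comp_id]; rfl⟩
    assoc := fun a b c => by
      obtain ⟨E, u, v, w, t, ξ, η, ζ, rfl, rfl, rfl⟩ := exists_rep₃ hB a b c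
      rw [IsComp.unique hB (spec _ _) ⟨E, u, v, w, ξ, η, rfl, rfl, rfl⟩,
        IsComp.unique hB (spec _ _) ⟨E, v, w, t, η, ζ, rfl, rfl, rfl⟩,
        IsComp.unique hB (spec _ _) ⟨E, u, w, t, ξ ≫ η, ζ, rfl, rfl, rfl⟩,
        IsComp.unique hB (spec _ _) ⟨E, u, v, t, ξ, η ≫ ζ, rfl, rfl, rfl⟩, Category.assoc] }

end Composition

/-! ### Pseudo-cocones of categories -/

section CoconeCalculus

variable {B : Type u₁} [Bicategory.{w₁, v₁} B] {F : B ⥤ᵖ Cat.{v, u}} {E : Cat.{v, u}}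

/-- The object `(C, F u (x))`, for `X = (A, x)` and `u : A ⟶ C`. -/
abbrev Obj.trans (X : Obj F) {C : B} (u : X.base ⟶ C) : Obj F := ⟨C, X.along u⟩

/-- The functor `F A ⥤ E` underlying a component of a pseudo-cocone. -/
abbrev PseudoCocone.fun (ψ : PseudoCocone F E) (A : B) : F.obj A ⥤ E := (ψ.app A).toFunctor

/-- The structure isomorphism `ψ C (F u (x)) ≅ ψ A (x)` of a pseudo-cocone. -/
def PseudoCocone.str (ψ : PseudoCocone F E) (X : Obj F) {C : B} (u : X.base ⟶ C) :
    (ψ.fun C).obj (X.along u) ≅ (ψ.fun X.base).obj X.fiber :=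
  (Cat.Hom.toNatIso (ψ.naturality u)).app X.fiber

namespace PseudoCocone

variable (ψ : PseudoCocone F E) {X Y : Obj F} {C D : B}

lemma map_cell_str {u u' : X.base ⟶ C} (α : u ⟶ u') :
    (ψ.fun C).map (cell X α) ≫ (ψ.str X u').hom = (ψ.str X u).hom := by
  -- The constant pseudofunctor contributes identities, here and below.
  have h := congr(($(ψ.naturality_naturality α)).toNatTrans.app X.fiber)
  exact h.trans (Category.comp_id _)

lemma map_map_str {A : B} {x y : F.obj A} (ξ : x ⟶ y) (u : A ⟶ C) :
    (ψ.fun C).map ((F.map u).toFunctor.map ξ) ≫ (ψ.str ⟨A, y⟩ u).hom =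
      (ψ.str ⟨A, x⟩ u).hom ≫ (ψ.fun A).map ξ :=
  (ψ.naturality u).hom.toNatTrans.naturality ξ

lemma str_unit (x : F.obj C) :
    (ψ.str ⟨C, x⟩ (𝟙 C)).hom = (ψ.fun C).map (unitIso C x).hom := by
  have h := congr(($(ψ.naturality_id C)).toNatTrans.app x)
  have h₁ := (Category.comp_id (ψ.str ⟨C, x⟩ (𝟙 C)).hom).symm.trans h
  have h₂ : (ψ.fun C).map (unitIso C x).hom ≫ 𝟙 _ ≫ 𝟙 _ = (ψ.fun C).map (unitIso C x).hom := by
    simp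
  exact h₁.trans h₂

lemma str_comp (X : Obj F) (u : X.base ⟶ C) (w : C ⟶ D) :
    (ψ.str X (u ≫ w)).hom = (ψ.fun D).map ((F.mapComp u w).hom.toNatTrans.app X.fiber) ≫
      (ψ.str (X.trans u) w).hom ≫ (ψ.str X u).hom := by
  have h := congr(($(ψ.naturality_comp u w)).toNatTrans.app X.fiber)
  have h₁ := (Category.comp_id (ψ.str X (u ≫ w)).hom).symm.trans h
  have h₂ : (ψ.fun D).map ((F.mapComp u w).hom.toNatTrans.app X.fiber) ≫ 𝟙 _ ≫
      (ψ.str (X.trans u) w).hom ≫ 𝟙 _ ≫ (ψ.str X u).hom ≫ 𝟙 _ =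
      (ψ.fun D).map ((F.mapComp u w).hom.toNatTrans.app X.fiber) ≫
      (ψ.str (X.trans u) w).hom ≫ (ψ.str X u).hom := by simp
  exact h₁.trans h₂

/-- Arrows pushed along `w` are carried by a pseudo-cocone to conjugates of the original ones. -/
lemma map_push_str {u : X.base ⟶ C} {v : Y.base ⟶ C} (w : C ⟶ D)
    (ξ : X.along u ⟶ Y.along v) :
    (ψ.fun D).map (push w ξ) ≫ (ψ.str Y (v ≫ w)).hom =
      (ψ.str X (u ≫ w)).hom ≫ (ψ.str X u).inv ≫ (ψ.fun C).map ξ ≫ (ψ.str Y v).hom := by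
  rw [str_comp, str_comp, push]
  simp only [Functor.map_comp, Category.assoc, Iso.hom_inv_id_assoc]
  rw [← Functor.map_comp_assoc _ ((F.mapComp v w).inv.toNatTrans.app Y.fiber),
    Cat.Hom.inv_hom_id_toNatTrans_app, CategoryTheory.Functor.map_id, Category.id_comp]
  rw [← reassoc_of% (map_map_str ψ ξ w)]

/-- The arrow of `E` induced by a premorphism. -/
def descMap (p : Premorphism X Y) :
    (ψ.fun X.base).obj X.fiber ⟶ (ψ.fun Y.base).obj Y.fiber :=
  (ψ.str X p.left).inv ≫ (ψ.fun p.apex).map p.hom ≫ (ψ.str Y p.right).hom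

lemma descMap_eq_of_homotopic {p q : Premorphism X Y} (h : Homotopic p q) :
    ψ.descMap p = ψ.descMap q := by
  obtain ⟨K, w₁, w₂, α, β, h⟩ := homotopic_iff.1 h
  have h' := congr((ψ.fun K).map $h ≫ (ψ.str Y (q.right ≫ w₂)).hom)
  rw [Functor.map_comp, Functor.map_comp, Category.assoc, Category.assoc, map_push_str,
    map_cell_str, map_push_str, reassoc_of% (map_cell_str ψ α.hom)] at h'
  exact ((cancel_epi _).1 h').symm

end PseudoCocone

/-- Pseudo-cocones are equal when their components are, and their structure isomorphisms agree
up to the identifications, that is, when there is a modification with components `eqToHom`. -/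
lemma PseudoCocone.ext_of_hom {ψ ψ' : PseudoCocone F E} (Γ : ψ ⟶ ψ')
    (h : ∀ A, ∃ e : ψ.app A = ψ'.app A, Γ.as.app A = eqToHom e) : ψ = ψ' := by
  obtain ⟨⟨m, hm⟩⟩ := Γ
  obtain ⟨a, n, _, _, _⟩ := ψ
  obtain ⟨a', n', _, _, _⟩ := ψ'
  obtain rfl : a = a' := funext fun A => (h A).1
  have key : @n = @n' := by
    funext A C u
    have hA : m A = 𝟙 (a A) := (h A).2
    have hC : m C = 𝟙 (a C) := (h C).2
    have := hm u
    rw [hA, hC] at this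
    ext1
    have h1 : F.map u ◁ 𝟙 (a C) ≫ (n' u).hom = (n u).hom ≫ 𝟙 (a A) ▷ (const B E).map u := this
    rw [whiskerLeft_id, id_whiskerRight] at h1
    exact ((Category.id_comp _).symm.trans (h1.trans (Category.comp_id _))).symm
  subst key
  rfl

/-- Naturality of a modification with respect to the structure isomorphisms. -/
lemma PseudoCocone.hom_str {ψ ψ' : PseudoCocone F E} (Γ : ψ ⟶ ψ') (X : Obj F) {C : B}
    (u : X.base ⟶ C) :
    (Γ.as.app C).toNatTrans.app (X.along u) ≫ (ψ'.str X u).hom =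
      (ψ.str X u).hom ≫ (Γ.as.app X.base).toNatTrans.app X.fiber :=
  congr(($(Γ.as.naturality u)).toNatTrans.app X.fiber)

/-- Modifications of pseudo-cocones are families of natural transformations commuting with the
structure isomorphisms. -/
def PseudoCocone.homMk {ψ ψ' : PseudoCocone F E} (τ : ∀ A, ψ.app A ⟶ ψ'.app A)
    (h : ∀ (X : Obj F) {C : B} (u : X.base ⟶ C),
      (τ C).toNatTrans.app (X.along u) ≫ (ψ'.str X u).hom =
        (ψ.str X u).hom ≫ (τ X.base).toNatTrans.app X.fiber) : ψ ⟶ ψ' where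
  as :=
    { app := τ
      naturality := fun {A C} u => by
        ext x
        exact h ⟨A, x⟩ u }

lemma PseudoCocone.eqToHom_app {ψ ψ' : PseudoCocone F E} (h : ψ = ψ') (A : B) :
    (eqToHom h : ψ ⟶ ψ').as.app A = eqToHom (h ▸ rfl) := by
  subst h
  rfl

/-- The structure isomorphisms of the cocone induced by a functor. -/
lemma PseudoCocone.str_comp_constMap {L : Cat.{v, u}} (θ : PseudoCocone F L) (G : L ⟶ E)
    (X : Obj F) {C : B} (u : X.base ⟶ C) :
    (PseudoCocone.str (θ ≫ constMap B G) X u).hom = G.toFunctor.map (θ.str X u).hom := by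
  have h : 𝟙 _ ≫ G.toFunctor.map (θ.str X u).hom ≫ 𝟙 _ ≫ (𝟙 _ ≫ 𝟙 _) ≫ 𝟙 _ =
      G.toFunctor.map (θ.str X u).hom := by simp
  exact h

end CoconeCalculus

/-! ### The universal cocone -/

section UniversalCocone

variable {B : Type u₁} [Bicategory.{w₁, v₁} B]

section Constraints

variable {F : B ⥤ᵖ Cat.{v, u}} {X Y Z : Obj F} {C D : B}

lemma cell_leftUnitor (x : F.obj C) (u : C ⟶ D) :
    cell ⟨C, x⟩ (λ_ u).hom =
      (F.mapComp (𝟙 C) u).hom.toNatTrans.app x ≫ (F.map u).toFunctor.map (unitIso C x).hom := by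
  simp [cell, unitIso]

/-- Pushing the constraint `F 1_C (F u (x)) ≅ F u (x)` along `w` gives the constraint
`F w (F u (x)) ≅ F (w u) (x)`. -/
lemma push_unitIso (X : Obj F) (u : X.base ⟶ C) (w : C ⟶ D) :
    cell (X.trans u) (λ_ w).inv ≫ push (X := X.trans u) (Y := X) w (unitIso C (X.along u)).hom =
      (F.mapComp u w).inv.toNatTrans.app X.fiber := by
  have h := cell_inv_hom_assoc (X := X.trans u) (λ_ w) ((F.mapComp u w).inv.toNatTrans.app X.fiber)
  rw [cell_leftUnitor, Category.assoc] at h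
  exact h

/-- The arrow of `F C` over the leg `1_C` given by `ξ : x ⟶ y` becomes `F u (ξ)` when pushed along
`u`. -/
lemma push_unit_conj {x y : F.obj C} (ξ : x ⟶ y) (u : C ⟶ D) :
    cell ⟨C, x⟩ (λ_ u).inv ≫
      push (X := ⟨C, x⟩) (Y := ⟨C, y⟩) u ((unitIso C x).hom ≫ ξ ≫ (unitIso C y).inv) ≫
        cell ⟨C, y⟩ (λ_ u).hom = (F.map u).toFunctor.map ξ := by
  have h : push (X := ⟨C, x⟩) (Y := ⟨C, y⟩) u ((unitIso C x).hom ≫ ξ ≫ (unitIso C y).inv) ≫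
      cell ⟨C, y⟩ (λ_ u).hom = cell ⟨C, x⟩ (λ_ u).hom ≫ (F.map u).toFunctor.map ξ := by
    rw [cell_leftUnitor, cell_leftUnitor, push]
    simp only [Category.assoc, Cat.Hom.inv_hom_id_toNatTrans_app_assoc, ← Functor.map_comp,
      Iso.inv_hom_id, Category.comp_id]
  rw [h, cell_inv_hom_assoc]

end Constraints

variable {F : B ⥤ᵖ Cat.{v, u}} (S : ColimCategory F)

/-- The objects of `Colim F`, carrying the category structure `S`. -/
def ColimCategory.Pt (_ : ColimCategory F) := Obj F

/-- The category structure `S` on the pairs `(A, x)`. -/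
instance : Category.{max u₁ v₁ v} S.Pt := S.category

namespace ColimCategory

/-- The pair `(A, x)` as an object of the category `S`. -/
def pt (X : Obj F) : S.Pt := X

/-- The arrow of the category `S` represented by `(C, u, v, ξ)`. -/
def arr {X Y : Obj F} {C : B} (u : X.base ⟶ C) (v : Y.base ⟶ C) (ξ : X.along u ⟶ Y.along v) :
    S.pt X ⟶ S.pt Y :=
  Premorphism.cls ⟨C, u, v, ξ⟩

variable {X Y Z : Obj F} {C D : B}

lemma arr_id (u : X.base ⟶ C) : S.arr u u (𝟙 (X.along u)) = 𝟙 (S.pt X) := cls_id X u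

lemma arr_push {u : X.base ⟶ C} {v : Y.base ⟶ C} (ξ : X.along u ⟶ Y.along v) (w : C ⟶ D)
    {u' : X.base ⟶ D} {v' : Y.base ⟶ D} (α : u ≫ w ≅ u') (β : v ≫ w ≅ v') :
    S.arr u' v' (cell X α.inv ≫ push w ξ ≫ cell Y β.hom) = S.arr u v ξ :=
  cls_push ⟨C, u, v, ξ⟩ w α β

lemma arr_comp (hB : IsPseudofiltered B) {u : X.base ⟶ C} {v : Y.base ⟶ C} {w : Z.base ⟶ C}
    (ξ : X.along u ⟶ Y.along v) (η : Y.along v ⟶ Z.along w) :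
    S.arr u v ξ ≫ S.arr v w η = S.arr u w (ξ ≫ η) := by
  obtain ⟨s⟩ := nonempty_oreSquare hB (⟨C, u, v, ξ⟩ : Premorphism X Y) ⟨C, v, w, η⟩
  exact (S.comp_cls _ _ s).trans
    (IsComp.unique hB (isComp_compOver _ _ s) ⟨C, u, v, w, ξ, η, rfl, rfl, rfl⟩)

/-- The right leg of a premorphism can be changed along an arbitrary 2-cell, since 2-cells become
invertible after whiskering. -/
lemma arr_comp_cell (hB : IsPseudofiltered B) {u : X.base ⟶ C} {v v' : Y.base ⟶ C}
    (ξ : X.along u ⟶ Y.along v) (α : v ⟶ v') : S.arr u v' (ξ ≫ cell Y α) = S.arr u v ξ := by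
  obtain ⟨K, s, _⟩ := hB.exists_isIso α
  let e : v ≫ s ≅ v' ≫ s := asIso (α ▷ s)
  have h : Homotopic (⟨C, u, v, ξ⟩ : Premorphism X Y) ⟨C, u, v', ξ ≫ cell Y α⟩ :=
    homotopic_iff.2 ⟨K, s, s, Iso.refl _, e, by simp [Sq, e, push_comp, push_cell]⟩
  exact (Quot.sound h).symm

/-- The functor `F C ⥤ Colim F` sending `x` to `(C, x)`. -/
abbrev incl (hB : IsPseudofiltered B) (C : B) : F.obj C ⥤ S.Pt where
  obj x := S.pt ⟨C, x⟩
  map {x y} ξ := S.arr (X := ⟨C, x⟩) (Y := ⟨C, y⟩) (𝟙 C) (𝟙 C)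
    ((unitIso C x).hom ≫ ξ ≫ (unitIso C y).inv)
  map_id x := by
    rw [Category.id_comp, Iso.hom_inv_id]
    exact S.arr_id (X := ⟨C, x⟩) (𝟙 C)
  map_comp ξ η := by
    rw [S.arr_comp hB]
    simp

/-- The isomorphism `(C, F u (x)) ≅ (A, x)` for `u : A ⟶ C`. -/
def inclIso (hB : IsPseudofiltered B) (X : Obj F) (u : X.base ⟶ C) :
    S.pt (X.trans u) ≅ S.pt X where
  hom := S.arr (X := X.trans u) (𝟙 C) u (unitIso C (X.along u)).hom
  inv := S.arr (Y := X.trans u) u (𝟙 C) (unitIso C (X.along u)).inv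
  hom_inv_id := by
    rw [S.arr_comp hB, Iso.hom_inv_id]
    exact S.arr_id (X := X.trans u) (𝟙 C)
  inv_hom_id := by
    rw [S.arr_comp hB, Iso.inv_hom_id]
    exact S.arr_id u

/-- An arrow `(C, u, v, ξ)` of `Colim F` is the image of `ξ` under the inclusion of `F C`, up to
the isomorphisms of its ends with objects over `C`. -/
lemma arr_eq (hB : IsPseudofiltered B) {u : X.base ⟶ C} {v : Y.base ⟶ C}
    (ξ : X.along u ⟶ Y.along v) :
    S.arr u v ξ = (S.inclIso hB X u).inv ≫ (S.incl hB C).map ξ ≫ (S.inclIso hB Y v).hom := by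
  dsimp only [inclIso, incl]
  rw [S.arr_comp hB, S.arr_comp hB]
  simp

lemma incl_map_inclIso (hB : IsPseudofiltered B) {A : B} {x y : F.obj A} (ξ : x ⟶ y) (u : A ⟶ C) :
    (S.incl hB C).map ((F.map u).toFunctor.map ξ) ≫ (S.inclIso hB ⟨A, y⟩ u).hom =
      (S.inclIso hB ⟨A, x⟩ u).hom ≫ (S.incl hB A).map ξ := by
  -- The arrow in `F A` is represented over `C` by its image under `F u`.
  have h : (S.incl hB A).map ξ = S.arr (X := ⟨A, x⟩) (Y := ⟨A, y⟩) u u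
      ((F.map u).toFunctor.map ξ) := by
    rw [← push_unit_conj]
    exact (S.arr_push (X := ⟨A, x⟩) (Y := ⟨A, y⟩) _ u (λ_ u) (λ_ u)).symm
  rw [h]
  dsimp only [inclIso, incl]
  rw [S.arr_comp hB, S.arr_comp hB]
  simp

lemma incl_map_cell_inclIso (hB : IsPseudofiltered B) (X : Obj F) {u u' : X.base ⟶ C}
    (α : u ⟶ u') :
    (S.incl hB C).map (cell X α) ≫ (S.inclIso hB X u').hom = (S.inclIso hB X u).hom := by
  dsimp only [inclIso, incl]
  rw [S.arr_comp hB]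
  rw [← S.arr_comp_cell hB _ α]
  simp

lemma inclIso_id (hB : IsPseudofiltered B) (X : Obj F) :
    (S.inclIso hB X (𝟙 _)).hom = (S.incl hB _).map (unitIso X.base X.fiber).hom := by
  dsimp only [inclIso, incl]
  rw [Iso.hom_inv_id, Category.comp_id]

lemma inclIso_comp (hB : IsPseudofiltered B) (X : Obj F) (u : X.base ⟶ C) (w : C ⟶ D) :
    (S.inclIso hB X (u ≫ w)).hom =
      (S.incl hB D).map ((F.mapComp u w).hom.toNatTrans.app X.fiber) ≫
        (S.inclIso hB (X.trans u) w).hom ≫ (S.inclIso hB X u).hom := by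
  -- Represented over `D`, the isomorphism for `u` is a functoriality constraint.
  have h : (S.inclIso hB X u).hom = S.arr (X := X.trans u) w (u ≫ w)
      ((F.mapComp u w).inv.toNatTrans.app X.fiber) := by
    rw [← push_unitIso]
    exact (S.arr_push (X := X.trans u) _ w (λ_ w) (Iso.refl _)).symm.trans (by simp)
  rw [h]
  dsimp only [inclIso, incl]
  rw [S.arr_comp hB, S.arr_comp hB]
  congr 1
  simp

/-- The pseudo-cocone on `F` formed by the inclusions. -/
def cocone (hB : IsPseudofiltered B) (F : B ⥤ᵖ Cat.{max u₁ v₁ v, max u₁ u}) (S : ColimCategory F) :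
    PseudoCocone F S.toCat :=
  ({  app := fun A => (S.incl hB A).toCatHom
      naturality := fun {A C} u =>
        Cat.Hom.isoMk (F := (F.map u).toFunctor ⋙ S.incl hB C) (G := S.incl hB A ⋙ 𝟭 _)
          (NatIso.ofComponents (fun x => S.inclIso hB ⟨A, x⟩ u)
            (fun ξ => S.incl_map_inclIso hB ξ u))
      naturality_naturality := fun {A C u u'} α => by
        ext x
        exact (S.incl_map_cell_inclIso hB ⟨A, x⟩ α).trans (Category.comp_id _).symm
      naturality_id := fun A => by
        ext x
        have h : (S.inclIso hB ⟨A, x⟩ (𝟙 _)).hom ≫ 𝟙 _ =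
            (S.incl hB A).map (unitIso A x).hom ≫ 𝟙 _ ≫ 𝟙 _ := by
          rw [S.inclIso_id, Category.id_comp]
        exact h
      naturality_comp := fun {A C D} u w => by
        ext x
        have h : (S.inclIso hB ⟨A, x⟩ (u ≫ w)).hom ≫ 𝟙 _ =
            (S.incl hB D).map ((F.mapComp u w).hom.toNatTrans.app x) ≫ 𝟙 _ ≫
              (S.inclIso hB (Obj.trans ⟨A, x⟩ u) w).hom ≫ 𝟙 _ ≫
                (S.inclIso hB ⟨A, x⟩ u).hom ≫ 𝟙 _ := by
          rw [S.inclIso_comp]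
          simp only [Category.id_comp]
          exact (Category.comp_id _).trans (_ ≫= _ ≫= (Category.comp_id _).symm)
        exact h } : Pseudofunctor.StrongTrans F (const B S.toCat))

end ColimCategory

end UniversalCocone

/-! ### The universal property -/

section Universal

variable {B : Type u₁} [Bicategory.{w₁, v₁} B]

/-- Functors are equal when a natural transformation between them consists of `eqToHom`s. -/
lemma functor_eq_of_app_eq_eqToHom {𝓒 𝓔 : Type*} [Category* 𝓒] [Category* 𝓔] {G H : 𝓒 ⥤ 𝓔}
    (σ : G ⟶ H) (h : ∀ X, ∃ e, σ.app X = eqToHom e) : G = H := by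
  refine CategoryTheory.Functor.ext (fun X => (h X).1) fun X Y a => ?_
  have n := σ.naturality a
  rw [(h X).2, (h Y).2] at n
  simp [← reassoc_of% n]

/-- Naturality of a family at `f` passes to conjugates of `f` by isomorphisms at which the family is
natural. -/
lemma naturality_conj {𝓒 𝓔 : Type*} [Category* 𝓒] [Category* 𝓔] {G H : 𝓒 ⥤ 𝓔} {X X' Y Y' : 𝓒}
    {tX : G.obj X ⟶ H.obj X} {tX' : G.obj X' ⟶ H.obj X'} {tY : G.obj Y ⟶ H.obj Y}
    {tY' : G.obj Y' ⟶ H.obj Y'} {i : X' ≅ X} {f : X' ⟶ Y'} {j : Y' ≅ Y}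
    (hi : tX' ≫ H.map i.hom = G.map i.hom ≫ tX) (hf : G.map f ≫ tY' = tX' ≫ H.map f)
    (hj : tY' ≫ H.map j.hom = G.map j.hom ≫ tY) :
    G.map (i.inv ≫ f ≫ j.hom) ≫ tY = tX ≫ H.map (i.inv ≫ f ≫ j.hom) := by
  rw [← cancel_epi (G.map i.hom), ← Functor.map_comp_assoc, Iso.hom_inv_id_assoc, ← reassoc_of% hi,
    ← Functor.map_comp, Iso.hom_inv_id_assoc, Functor.map_comp, Category.assoc, ← hj,
    reassoc_of% hf, Functor.map_comp]

namespace ColimCategory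

variable {F : B ⥤ᵖ Cat.{v, u}} (S : ColimCategory F)

/-- The functor out of `Colim F` induced by a pseudo-cocone. -/
def desc (hB : IsPseudofiltered B) {E : Cat.{v, u}} (ψ : PseudoCocone F E) : S.Pt ⥤ E where
  obj X := (ψ.fun (Obj.base X)).obj (Obj.fiber X)
  map a := Quot.lift (fun p => ψ.descMap p) (fun _ _ h => ψ.descMap_eq_of_homotopic h) a
  map_id X := by
    refine (congrArg _ (S.arr_id (X := X) (𝟙 _)).symm).trans ?_
    simp [arr, Premorphism.cls, PseudoCocone.descMap]
  map_comp {X Y Z} a b := by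
    obtain ⟨_, C, u, v, w, ξ, η, rfl, rfl, -⟩ := exists_isComp hB a b
    refine (congrArg _ (S.arr_comp hB ξ η)).trans ?_
    simp [arr, Premorphism.cls, PseudoCocone.descMap]

lemma desc_map_incl (hB : IsPseudofiltered B) {E : Cat.{v, u}} (ψ : PseudoCocone F E)
    {C : B} {x y : F.obj C} (ξ : x ⟶ y) :
    (S.desc hB ψ).map ((S.incl hB C).map ξ) = (ψ.fun C).map ξ := by
  have h : (ψ.str ⟨C, x⟩ (𝟙 C)).inv ≫ (ψ.fun C).map ((unitIso C x).hom ≫ ξ ≫ (unitIso C y).inv) ≫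
      (ψ.str ⟨C, y⟩ (𝟙 C)).hom = (ψ.fun C).map ξ := by
    rw [Iso.inv_comp_eq, ψ.str_unit, ψ.str_unit]
    simp [← Functor.map_comp]
  exact h

lemma desc_map_inclIso (hB : IsPseudofiltered B) {E : Cat.{v, u}} (ψ : PseudoCocone F E)
    {C : B} (X : Obj F) (u : X.base ⟶ C) :
    (S.desc hB ψ).map (S.inclIso hB X u).hom = (ψ.str X u).hom := by
  have h : (ψ.str (X.trans u) (𝟙 C)).inv ≫ (ψ.fun C).map (unitIso C (X.along u)).hom ≫
      (ψ.str X u).hom = (ψ.str X u).hom := by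
    rw [Iso.inv_comp_eq, ψ.str_unit]
  exact h

/-- A family of arrows that is natural along the inclusions and along the isomorphisms
`(C, F u (x)) ≅ (A, x)` is natural, since these generate the category. -/
lemma naturality_of_incl (hB : IsPseudofiltered B) {𝓔 : Type*} [Category* 𝓔] {G H : S.Pt ⥤ 𝓔}
    (t : ∀ X : Obj F, G.obj (S.pt X) ⟶ H.obj (S.pt X))
    (h_incl : ∀ {C : B} {x y : F.obj C} (ξ : x ⟶ y), G.map ((S.incl hB C).map ξ) ≫ t ⟨C, y⟩ =
      t ⟨C, x⟩ ≫ H.map ((S.incl hB C).map ξ))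
    (h_iso : ∀ (X : Obj F) {C : B} (u : X.base ⟶ C), t (X.trans u) ≫ H.map (S.inclIso hB X u).hom =
      G.map (S.inclIso hB X u).hom ≫ t X)
    {X Y : Obj F} {C : B} {u : X.base ⟶ C} {v : Y.base ⟶ C} (ξ : X.along u ⟶ Y.along v) :
    G.map (S.arr u v ξ) ≫ t Y = t X ≫ H.map (S.arr u v ξ) := by
  rw [S.arr_eq hB]
  exact naturality_conj (h_iso X u) (h_incl ξ) (h_iso Y v)

end ColimCategory

section IsPseudoColimit

variable (hB : IsPseudofiltered B) {F : B ⥤ᵖ Cat.{max u₁ v₁ v, max u₁ u}} (S : ColimCategory F)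
  {E : Cat.{max u₁ v₁ v, max u₁ u}}

include hB

/-- Every pseudo-cocone is induced by a functor. -/
lemma desc_fac (ψ : PseudoCocone F E) :
    ∃ G : S.toCat ⟶ E,
      (inducedFunctor (ColimCategory.cocone.{w₁, v₁, u₁, v, u} hB F S) E).obj G = ψ := by
  let θ := ColimCategory.cocone.{w₁, v₁, u₁, v, u} hB F S
  let G : S.toCat ⟶ E := (S.desc hB ψ).toCatHom
  -- On objects the induced cocone is `ψ` by definition, so the comparison consists of identities.
  let τ (A : B) : (θ ≫ constMap B G).app A ⟶ ψ.app A :=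
    ⟨{ app := fun x => 𝟙 _
       naturality := fun x y ξ => (Category.comp_id _).trans
        ((S.desc_map_incl hB ψ ξ).trans (Category.id_comp _).symm) }⟩
  refine ⟨G, PseudoCocone.ext_of_hom (PseudoCocone.homMk τ fun X C u => ?_) fun A => ?_⟩
  · exact (Category.id_comp _).trans ((S.desc_map_inclIso hB ψ X u).symm.trans
      ((PseudoCocone.str_comp_constMap θ G X u).symm.trans (Category.comp_id _).symm))
  · have e : (θ ≫ constMap B G).app A = ψ.app A :=
      Cat.ext (CategoryTheory.Functor.ext (fun x => rfl) fun x y ξ =>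
        (S.desc_map_incl hB ψ ξ).trans
          ((Category.id_comp _).trans (Category.comp_id _)).symm)
    refine ⟨e, ?_⟩
    ext x
    exact (Cat.eqToHom_app _ _ e x).symm

/-- Modifications between induced cocones are induced by unique natural transformations. -/
lemma inducedFunctor_map_bijective (G H : S.toCat ⟶ E) :
    Function.Bijective (fun σ : G ⟶ H =>
      (inducedFunctor (ColimCategory.cocone.{w₁, v₁, u₁, v, u} hB F S) E).map σ) := by
  constructor
  · intro σ τ h
    ext X
    exact congr((($h).as.app (Obj.base X)).toNatTrans.app (Obj.fiber X))
  · intro Γ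
    let t (X : Obj F) : G.toFunctor.obj (S.pt X) ⟶ H.toFunctor.obj (S.pt X) :=
      (Γ.as.app X.base).toNatTrans.app X.fiber
    have ht (X : Obj F) {C : B} (u : X.base ⟶ C) :
        t (X.trans u) ≫ H.toFunctor.map (S.inclIso hB X u).hom =
          G.toFunctor.map (S.inclIso hB X u).hom ≫ t X := by
      have h := PseudoCocone.hom_str Γ X u
      erw [PseudoCocone.str_comp_constMap, PseudoCocone.str_comp_constMap] at h
      exact h
    exact ⟨⟨{ app := t
              naturality := fun X Y a => by
                obtain ⟨p, rfl⟩ := Quot.exists_rep a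
                exact S.naturality_of_incl hB (G := G.toFunctor) (H := H.toFunctor) t
                  (fun ξ => (Γ.as.app _).toNatTrans.naturality ξ) ht p.hom }⟩, rfl⟩

/-- A functor is determined by the cocone it induces: the identity modification lifts to a natural
transformation. -/
lemma inducedFunctor_obj_injective :
    Function.Injective
      (inducedFunctor (ColimCategory.cocone.{w₁, v₁, u₁, v, u} hB F S) E).obj := by
  intro G H h
  obtain ⟨σ, hσ⟩ := (inducedFunctor_map_bijective hB S G H).2 (eqToHom h)
  have hσ' (X : Obj F) : ∃ e, σ.toNatTrans.app X = eqToHom e :=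
    ⟨_, (congr((($hσ).as.app X.base).toNatTrans.app X.fiber)).trans (by
      rw [PseudoCocone.eqToHom_app]
      exact Cat.eqToHom_app _ _ _ _)⟩
  exact Cat.ext (functor_eq_of_app_eq_eqToHom σ.toNatTrans hσ')

end IsPseudoColimit

end Universal
end PseudoColim

theorem mainTheorem5 {B : Type u₁} [CategoryTheory.Bicategory.{w₁, v₁} B]
    (hB : PseudoColim.IsPseudofiltered B)
    (F : CategoryTheory.Pseudofunctor B CategoryTheory.Cat.{max u₁ v₁ v, max u₁ u}) :
    -- homotopy is an equivalence relation
    (∀ X Y : PseudoColim.Obj F,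
      Equivalence (PseudoColim.Homotopic (X := X) (Y := Y))) ∧
    -- squares `γ` exist for all composable premorphisms
    (∀ (X Y Z : PseudoColim.Obj F) (p : PseudoColim.Premorphism X Y)
      (q : PseudoColim.Premorphism Y Z), Nonempty (PseudoColim.OreSquare p q)) ∧
    -- the described data form a category, and it is a pseudo-colimit of `F`
    (∃ S : PseudoColim.ColimCategory F, PseudoColim.IsPseudoColimit F S.toCat) := by
  refine ⟨PseudoColim.homotopic_equivalence hB, fun _ _ _ => PseudoColim.nonempty_oreSquare hB,
    PseudoColim.colimCategory hB F,
    PseudoColim.ColimCategory.cocone.{w₁, v₁, u₁, v, u} hB F (PseudoColim.colimCategory hB F),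
    fun E => ⟨⟨PseudoColim.inducedFunctor_obj_injective hB _, PseudoColim.desc_fac hB _⟩,
      PseudoColim.inducedFunctor_map_bijective hB _⟩⟩
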